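/- Consider a $(G,K,M\times N)$ cluster: $G$ cells, each with one base station (BS) having $N$ antennas and $K$ users having $M$ antennas each, every user being served one data stream. For $1\le i,g\le G$ and $1\le k\le K$ let $\mathbf H_{(i,gk)}\in\mathbb C^{M\times N}$ be the channel from BS $i$ to the $k$th user of cell $g$. Let $\mathcal I\subseteq\{(i,gk): i\ne g\}$ be a set of BS-user pairs. Partial interference alignment (IA) for $\mathcal I$ is called feasible if there are nonzero receive beamformers $\mathbf u_{gk}\in\mathbb C^M$ and transmit beamformers $\mathbf v_{gk}\in\mathbb C^N$ such that $\mathbf v_{g1},\dots,\mathbf v_{gK}$ are linearly independent for every $g$ and $$\mathbf u_{gk}^H\,\mathbf H_{(i,gk)}\,\mathbf v_{ij}=0\qquad\text{for all }(i,gk)\in\mathcal I\text{ and all }j\in\{1,\dots,K\}.$$ A property holds for generic channels if it holds for all channels $(\mathbf H_{(i,gk)})_{i,g,k}$ in some nonempty Zariski open subset of the complex affine space of all channel coefficients. Let $1\le q\le G-1$ and suppose that for every user $gk$ there are at most $q$ BSs $i$ with $(i,gk)\in\mathcal I$, and for every BS $i$ there are at most $Kq$ users $gk$ with $(i,gk)\in\mathcal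 I$. If $$M\ge 1,\qquad N\ge K,\qquad M+N\ge K(q+1)+1,$$ then partial IA for $\mathcal I$ is feasible for generic channels. In particular (the case $q=G-1$), if $G\ge 2$, $M\ge1$, $N\ge K$ and $M+N\ge GK+1$, then complete IA, that is, partial IA for the set of all $(G-1)GK$ pairs $(i,gk)$ with $i\neq g$, is feasible for generic channels. -/

import Mathlib

open Matrix

/-- Indices of the scalar channel coefficients of a `(G, K, M × N)` cluster: `(i, (g, k), m, n)`
is the entry `(m, n)` of the `M × N` channel from BS `i` to the `k`-th user of cell `g`. -/
abbrev ChannelIndex (G K M N : ℕ) : Type :=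
  Fin G × (Fin G × Fin K) × Fin M × Fin N

/-- The `M × N` channel matrix from BS `i` to the user `a = (g, k)`. -/
def channelMatrix {G K M N : ℕ} (h : ChannelIndex G K M N → ℂ) (i : Fin G) (a : Fin G × Fin K) :
    Matrix (Fin M) (Fin N) ℂ :=
  Matrix.of fun m n => h (i, a, m, n)

/-- The receive beamformers `u` and transmit beamformers `v` solve the partial interference
alignment problem for the set `I` of BS-user pairs: receive beamformers are nonzero, the transmit
beamformers of each BS are linearly independent, and for every pair `(i, a) ∈ I` each of the `K`
signals of BS `i` is nulled at the user `a`. -/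
structure IsAligned {G K M N : ℕ} (h : ChannelIndex G K M N → ℂ)
    (I : Finset (Fin G × (Fin G × Fin K)))
    (u : Fin G × Fin K → Fin M → ℂ) (v : Fin G × Fin K → Fin N → ℂ) : Prop where
  receive_ne_zero : ∀ a, u a ≠ 0
  transmit_linearIndependent : ∀ g : Fin G, LinearIndependent ℂ fun k : Fin K => v (g, k)
  nulled : ∀ i a, (i, a) ∈ I → ∀ j : Fin K,
    star (u a) ⬝ᵥ (channelMatrix h i a *ᵥ v (i, j)) = 0

/-- Partial interference alignment for `I` is feasible for the channel coefficients `h`. -/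
def PartialIAFeasible {G K M N : ℕ} (h : ChannelIndex G K M N → ℂ)
    (I : Finset (Fin G × (Fin G × Fin K))) : Prop :=
  ∃ (u : Fin G × Fin K → Fin M → ℂ) (v : Fin G × Fin K → Fin N → ℂ), IsAligned h I u v

/-- A subset of affine space is Zariski open if it is the complement of the common zero set of
some set of polynomials. -/
def IsZariskiOpen {σ : Type*} (U : Set (σ → ℂ)) : Prop :=
  ∃ S : Set (MvPolynomial σ ℂ), U = {x | ∀ p ∈ S, MvPolynomial.eval x p = 0}ᶜ

/-- A property of points of affine space is generic if it holds on a nonempty Zariski open set. -/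
def HoldsGenerically {σ : Type*} (P : (σ → ℂ) → Prop) : Prop :=
  ∃ U : Set (σ → ℂ), U.Nonempty ∧ IsZariskiOpen U ∧ ∀ x ∈ U, P x

/-- The set of all `(G - 1) G K` BS-user pairs in which the BS is not in the cell of the user. -/
def allPairs (G K : ℕ) : Finset (Fin G × (Fin G × Fin K)) :=
  Finset.univ.filter fun p => p.2.1 ≠ p.1

/-! Normalise the receive beamformers to begin with 1 and the transmit beamformers of each BS to
begin with the identity, leaving `m = M - 1` and `n = N - K` free coordinates. Each alignment
equation can then be solved for one channel coefficient, so feasible channels contain the image of a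
polynomial map (`alignedChannel`). By Chevalley's theorem it suffices that this map is dominant,
hence that its derivative is onto at one point. With zero free coordinates at that point, this is
solvability of `α · y + x · β = w` for one choice of `α`, `β`. Join user `a` to stream `(i, j)` when
`(i, a) ∈ I`: degrees are at most `K * q ≤ m + n`, so König's theorem colours the edges with `m + n`
colours. The first `n` colours are handled by the transmit unknowns `y`, the other `m` by the
receive unknowns `x`. -/

/-! ### Dominant polynomial maps -/

open MvPolynomial in
/-- The image of a dominant polynomial map contains a nonempty Zariski open set. -/
theorem holdsGenerically_of_injective_bind₁ {σ τ : Type*} [Finite σ] [Finite τ]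
    {P : (σ → ℂ) → Prop} (F : σ → MvPolynomial τ ℂ) (hF : Function.Injective (bind₁ F))
    (hP : ∀ t : τ → ℂ, P fun s => eval t (F s)) : HoldsGenerically P := by
  let φ : MvPolynomial σ ℂ →+* MvPolynomial τ ℂ := (bind₁ F).toRingHom
  have hφ : φ.FinitePresentation :=
    RingHom.FinitePresentation.of_finiteType.mp <| by
      have h : ((bind₁ F).toRingHom.comp (C : ℂ →+* MvPolynomial σ ℂ)).FiniteType := by
        have : (bind₁ F).toRingHom.comp (C : ℂ →+* MvPolynomial σ ℂ) = algebraMap ℂ _ := by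
          ext; simp [algebraMap_eq]
        rw [this, RingHom.finiteType_algebraMap]
        infer_instance
      exact RingHom.FiniteType.of_comp_finiteType h
  obtain ⟨S, hS⟩ := PrimeSpectrum.exists_constructibleSetData_iff.mpr
    (PrimeSpectrum.isConstructible_range_comap hφ)
  have hbot : (⊥ : PrimeSpectrum (MvPolynomial σ ℂ)) ∈ S.toSet := by
    rw [hS]
    refine ⟨⊥, PrimeSpectrum.ext ?_⟩
    exact (RingHom.injective_iff_ker_eq_bot φ).mp hF
  simp only [PrimeSpectrum.ConstructibleSetData.toSet, Set.mem_iUnion] at hbot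
  obtain ⟨B, hB, hBbot⟩ := hbot
  -- The piece `V(g) \ V(f)` contains the generic point, so it is the nonempty basic open set of
  -- `f`.
  have hg : ∀ i, B.g i = 0 := by
    intro i
    have := hBbot.1 (Set.mem_range_self i)
    simpa using this
  have hf : B.f ≠ 0 := by
    intro h
    apply hBbot.2
    simp [h]
  refine ⟨{x | ∀ p ∈ ({B.f} : Set (MvPolynomial σ ℂ)), eval x p = 0}ᶜ, ?_, ⟨_, rfl⟩, ?_⟩
  · by_contra hne
    rw [Set.not_nonempty_iff_eq_empty, Set.compl_empty_iff] at hne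
    refine hf (MvPolynomial.funext fun x => ?_)
    have : x ∈ {x | ∀ p ∈ ({B.f} : Set (MvPolynomial σ ℂ)), eval x p = 0} := hne ▸ Set.mem_univ x
    simpa using this
  · intro x hx
    have hx' : eval x B.f ≠ 0 := by simpa using hx
    let 𝔭 : PrimeSpectrum (MvPolynomial σ ℂ) := ⟨RingHom.ker (eval x), RingHom.ker_isPrime _⟩
    have hp : 𝔭 ∈ S.toSet := by
      simp only [PrimeSpectrum.ConstructibleSetData.toSet, Set.mem_iUnion]
      refine ⟨B, hB, ?_, ?_⟩
      · rintro _ ⟨i, rfl⟩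
        simp [hg]
      · intro h
        exact hx' (by simpa [𝔭] using h)
    rw [hS] at hp
    obtain ⟨Q, hQ⟩ := hp
    -- `Q` may not be a closed point; any maximal ideal above it still contains every `F s - x s`,
    -- and by the Nullstellensatz it is a point `t`.
    obtain ⟨J, hJ, hQJ⟩ := Ideal.exists_le_maximal Q.asIdeal Q.isPrime.ne_top
    obtain ⟨t, rfl⟩ := isMaximal_iff_eq_vanishingIdeal_singleton.mp hJ
    convert hP t with s
    have h1 : X s - C (x s) ∈ 𝔭.asIdeal := by simp [𝔭]
    rw [← hQ] at h1
    have h2 := hQJ h1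
    have h3 := (mem_vanishingIdeal_singleton_iff t _).mp h2
    simp [φ, sub_eq_zero] at h3
    exact h3.symm

open MvPolynomial in
/-- A polynomial map whose directional derivatives at some point attain every value is
dominant. -/
theorem injective_bind₁_of_hasDerivAt {σ τ : Type*} [Fintype σ] [Fintype τ]
    (F : σ → MvPolynomial τ ℂ) (p : τ → ℂ)
    (h : ∀ w : σ → ℂ, ∃ v : τ → ℂ, ∀ s,
      HasDerivAt (fun z : ℂ => eval (p + z • v) (F s)) (w s) 0) :
    Function.Injective (bind₁ F) := by
  let f : (τ → ℂ) → σ → ℂ := fun t s => eval t (F s)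
  have hf : AnalyticAt ℂ f p := by
    rw [analyticAt_pi_iff]
    intro s
    have := AnalyticOnNhd.eval_mvPolynomial (𝕜 := ℂ) (F s)
    exact this p (Set.mem_univ _)
  have hd := hf.hasStrictFDerivAt
  have hsurj : (fderiv ℂ f p).range = ⊤ := by
    rw [LinearMap.range_eq_top]
    intro w
    obtain ⟨v, hv⟩ := h w
    refine ⟨v, ?_⟩
    have h1 : HasDerivAt (fun z : ℂ => f (p + z • v)) w 0 := hasDerivAt_pi.mpr hv
    have h2 : HasDerivAt (fun z : ℂ => p + z • v) v 0 := by
      simpa using ((hasDerivAt_id (0 : ℂ)).smul_const v).const_add p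
    have h3 := HasFDerivAt.comp_hasDerivAt_of_eq (0 : ℂ) hd.hasFDerivAt h2 (by simp)
    exact h3.unique h1
  -- A submersion is locally open, so the image contains a ball, on which no nonzero polynomial
  -- vanishes.
  have hn := hd.map_nhds_eq_of_surj hsurj
  have hr : Set.range f ∈ nhds (f p) := by
    rw [← hn]
    exact Filter.mem_map.mpr (Filter.mem_of_superset Filter.univ_mem fun t _ => ⟨t, rfl⟩)
  obtain ⟨ε, hε, hball⟩ := Metric.mem_nhds_iff.mp hr
  rw [injective_iff_map_eq_zero]
  intro q hq
  refine funext_set (fun s => Metric.ball (f p s) ε) (fun s => ?_) fun x hx => ?_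
  · exact infinite_of_mem_nhds (f p s) (Metric.ball_mem_nhds _ hε)
  · rw [← ball_pi _ hε] at hx
    obtain ⟨t, rfl⟩ := hball hx
    have h4 := congrArg (eval t) hq
    rw [← coe_aeval_eq_eval, RingHom.coe_coe, aeval_bind₁] at h4
    simpa [f, aeval_eq_eval, coe_aeval_eq_eval] using h4

/-! ### Bipartite edge colouring -/

/-- A square matrix of natural numbers with all row and column sums equal to `D` is a sum of `D`
permutation matrices. -/
theorem exists_perm_decomposition {V : Type*} [Fintype V] [DecidableEq V] (D : ℕ)
    (A : V → V → ℕ) (hrow : ∀ u, ∑ v, A u v = D) (hcol : ∀ v, ∑ u, A u v = D) :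
    ∃ π : Fin D → Equiv.Perm V, ∀ u v, A u v = ∑ t, if π t u = v then 1 else 0 := by
  induction D generalizing A with
  | zero =>
    refine ⟨fun _ => 1, fun u v => ?_⟩
    simpa using Finset.sum_eq_zero_iff.mp (hrow u) v (Finset.mem_univ v)
  | succ D ih =>
    -- Hall's condition by double counting: the rows in `s` have total weight `(D + 1) * s.card`,
    -- all of it in the columns `N`, which carry only `(D + 1) * N.card`.
    obtain ⟨f, hinj, hf⟩ := (Finset.all_card_le_biUnion_card_iff_exists_injective
      fun u => Finset.univ.filter fun v => A u v ≠ 0).mp fun s => by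
        refine Nat.le_of_mul_le_mul_left ?_ (Nat.succ_pos D)
        set N := s.biUnion fun u => Finset.univ.filter fun v => A u v ≠ 0 with hN
        calc (D + 1) * s.card = ∑ u ∈ s, ∑ v, A u v := by simp [hrow, mul_comm]
          _ = ∑ u ∈ s, ∑ v ∈ N, A u v := by
            refine Finset.sum_congr rfl fun u hu => (Finset.sum_subset (Finset.subset_univ N) ?_).symm
            intro v _ hv
            by_contra h
            exact hv (Finset.mem_biUnion.mpr ⟨u, hu, by simpa using h⟩)
          _ = ∑ v ∈ N, ∑ u ∈ s, A u v := Finset.sum_comm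
          _ ≤ ∑ v ∈ N, ∑ u, A u v :=
            Finset.sum_le_sum fun v _ => Finset.sum_le_sum_of_subset (Finset.subset_univ s)
          _ = (D + 1) * N.card := by simp [hcol, mul_comm]
    let ρ : Equiv.Perm V := Equiv.ofBijective f (Finite.injective_iff_bijective.mp hinj)
    have hρ : ∀ u, A u (ρ u) ≠ 0 := fun u => (Finset.mem_filter.mp (hf u)).2
    have hle : ∀ u v, (if ρ u = v then 1 else 0) ≤ A u v := fun u v => by
      split_ifs with h
      · exact h ▸ Nat.one_le_iff_ne_zero.mpr (hρ u)
      · exact Nat.zero_le _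
    obtain ⟨π, hπ⟩ := ih (fun u v => A u v - if ρ u = v then 1 else 0)
      (fun u => by
        rw [Finset.sum_tsub_distrib _ fun v _ => hle u v, hrow]
        simp)
      (fun v => by
        rw [Finset.sum_tsub_distrib _ fun u _ => hle u v, hcol]
        simp [← Equiv.eq_symm_apply])
    refine ⟨Fin.cons ρ π, fun u v => ?_⟩
    rw [Fin.sum_univ_succ]
    simp only [Fin.cons_zero, Fin.cons_succ, ← hπ]
    have := hle u v
    omega

/-- A bipartite graph of maximum degree at most `D` has a proper edge colouring with `D`
colours. -/
theorem exists_bipartite_edge_coloring {L R : Type*} [Fintype L] [Fintype R]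
    (E : L → R → Prop) [∀ l r, Decidable (E l r)] (D : ℕ)
    (hL : ∀ l, (Finset.univ.filter fun r => E l r).card ≤ D)
    (hR : ∀ r, (Finset.univ.filter fun l => E l r).card ≤ D) :
    ∃ c : L → R → ℕ, (∀ l r, E l r → c l r < D) ∧
      (∀ l r r', E l r → E l r' → c l r = c l r' → r = r') ∧
      (∀ l l' r, E l r → E l' r → c l r = c l' r → l = l') := by
  classical
  -- The symmetric adjacency matrix, with the missing degree put on the diagonal to make all sums
  -- `D`; each permutation then yields a matching.
  let A : L ⊕ R → L ⊕ R → ℕ := fun x y => match x, y with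
    | .inl l, .inr r => if E l r then 1 else 0
    | .inl l, .inl l' => if l = l' then D - (Finset.univ.filter fun r => E l r).card else 0
    | .inr r, .inr r' => if r = r' then D - (Finset.univ.filter fun l => E l r).card else 0
    | .inr r, .inl l => if E l r then 1 else 0
  obtain ⟨π, hπ⟩ := exists_perm_decomposition D A
    (by
      rintro (l | r)
      · have := hL l
        simp only [A, Fintype.sum_sum_type, Finset.sum_ite_eq, Finset.mem_univ, if_true,
          Finset.sum_boole, Nat.cast_id]
        omega
      · have := hR r
        simp only [A, Fintype.sum_sum_type, Finset.sum_ite_eq, Finset.mem_univ, if_true,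
          Finset.sum_boole, Nat.cast_id]
        omega)
    (by
      rintro (l | r)
      · have := hL l
        simp only [A, Fintype.sum_sum_type, Finset.sum_ite_eq', Finset.mem_univ, if_true,
          Finset.sum_boole, Nat.cast_id]
        omega
      · have := hR r
        simp only [A, Fintype.sum_sum_type, Finset.sum_ite_eq', Finset.mem_univ, if_true,
          Finset.sum_boole, Nat.cast_id]
        omega)
  have hex : ∀ l r, E l r → ∃ t, π t (.inl l) = .inr r := by
    intro l r h
    by_contra! hne
    have := hπ (.inl l) (.inr r)
    simp [A, h, hne] at this
  let c : L → R → ℕ := fun l r => if h : E l r then (hex l r h).choose else 0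
  have hc : ∀ l r, E l r → ∃ t : Fin D, c l r = t ∧ π t (.inl l) = .inr r := fun l r h =>
    ⟨(hex l r h).choose, by simp [c, h], (hex l r h).choose_spec⟩
  refine ⟨c, fun l r h => ?_, fun l r r' h h' e => ?_, fun l l' r h h' e => ?_⟩
  · obtain ⟨t, ht, -⟩ := hc l r h
    exact ht ▸ t.2
  · obtain ⟨t, ht, hr⟩ := hc l r h
    obtain ⟨t', ht', hr'⟩ := hc l r' h'
    obtain rfl : t = t' := Fin.ext (by omega)
    exact Sum.inr_injective (hr.symm.trans hr')
  · obtain ⟨t, ht, hr⟩ := hc l r h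
    obtain ⟨t', ht', hr'⟩ := hc l' r h'
    obtain rfl : t = t' := Fin.ext (by omega)
    exact Sum.inl_injective ((π t).injective (hr.trans hr'.symm))

/-! ### The linearised alignment equations -/

/-- Values at at most `n` distinct nodes are attained by some linear combination of the first `n`
monomials. -/
theorem exists_coeff_interpolation {ι : Type*} (s : Finset ι) (n : ℕ)
    (hs : s.card ≤ n) (x : ι → ℂ) (hx : Function.Injective x) (w : ι → ℂ) :
    ∃ y : Fin n → ℂ, ∀ a ∈ s, ∑ k : Fin n, x a ^ (k : ℕ) * y k = w a := by
  classical
  have hp : Lagrange.interpolate s x w ∈ Polynomial.degreeLT ℂ n :=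
    Polynomial.mem_degreeLT.mpr
      ((Lagrange.degree_interpolate_lt w hx.injOn).trans_le (by exact_mod_cast hs))
  refine ⟨Polynomial.degreeLTEquiv ℂ n ⟨_, hp⟩, fun a ha => ?_⟩
  rw [← Lagrange.eval_interpolate_at_node w hx.injOn ha, Polynomial.eval_eq_sum_degreeLTEquiv hp]
  exact Finset.sum_congr rfl fun k _ => mul_comm _ _

/-- For suitable coefficients, the linearised alignment equations are solvable for all right-hand
sides. -/
theorem exists_linearized_surjective {G K m n q : ℕ} (hD : K * q ≤ m + n)
    (I : Finset (Fin G × (Fin G × Fin K)))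
    (hU : ∀ a : Fin G × Fin K, (Finset.univ.filter fun i : Fin G => (i, a) ∈ I).card ≤ q)
    (hB : ∀ i : Fin G,
      (Finset.univ.filter fun a : Fin G × Fin K => (i, a) ∈ I).card ≤ K * q) :
    ∃ (α : Fin G → Fin G × Fin K → Fin n → ℂ) (β : Fin G → Fin G × Fin K → Fin K → Fin m → ℂ),
      ∀ w : Fin G → Fin G × Fin K → Fin K → ℂ,
        ∃ (x : Fin G × Fin K → Fin m → ℂ) (y : Fin G → Fin K → Fin n → ℂ),
          ∀ i a, (i, a) ∈ I → ∀ j,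
            ∑ l, α i a l * y i j l + ∑ t, x a t * β i a j t = w i a j := by
  classical
  obtain ⟨c, hlt, hcL, hcR⟩ := exists_bipartite_edge_coloring
    (fun (a : Fin G × Fin K) (r : Fin G × Fin K) => (r.1, a) ∈ I) (K * q)
    (fun a => by
      have : (Finset.univ.filter fun r : Fin G × Fin K => (r.1, a) ∈ I) =
          (Finset.univ.filter fun i : Fin G => (i, a) ∈ I) ×ˢ Finset.univ := by
        ext; simp
      rw [this, Finset.card_product, Finset.card_univ, Fintype.card_fin, mul_comm]
      exact Nat.mul_le_mul_left K (hU a))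
    (fun r => hB r.1)
  let node : Fin G × Fin K → ℂ := fun a => ((Fintype.equivFin _ a : ℕ) : ℂ)
  have hnode : Function.Injective node := fun a b h => by
    simpa [node, Fin.val_inj] using h
  -- `α` is shared by all streams `j` of a BS, so it cannot follow the colouring; Vandermonde rows
  -- make any `n` users independent. `β` may depend on `j` and is the indicator of the colour. It
  -- vanishes for colours below `n`, so the system is triangular: `y` first, then `x`.
  refine ⟨fun _ a l => node a ^ (l : ℕ), fun i a j t => if c a (i, j) = n + t then 1 else 0,
    fun w => ?_⟩
  have hy : ∀ i j, ∃ y : Fin n → ℂ, ∀ a, (i, a) ∈ I → c a (i, j) < n →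
      ∑ l : Fin n, node a ^ (l : ℕ) * y l = w i a j := by
    intro i j
    obtain ⟨y, hy⟩ := exists_coeff_interpolation
      (Finset.univ.filter fun a => (i, a) ∈ I ∧ c a (i, j) < n) n
      (by
        rw [← Finset.card_range n]
        refine Finset.card_le_card_of_injOn (fun a => c a (i, j)) ?_ ?_
        · intro a ha
          simp only [Finset.coe_filter, Finset.mem_univ, true_and, Set.mem_ofPred_eq] at ha
          simpa using ha.2
        · intro a ha b hb h
          simp only [Finset.coe_filter, Finset.mem_univ, true_and, Set.mem_ofPred_eq] at ha hb
          exact hcR a b (i, j) ha.1 hb.1 h)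
      node hnode (fun a => w i a j)
    exact ⟨y, fun a h1 h2 => hy a (by simp [h1, h2])⟩
  choose y hy using hy
  -- Edges at `a` have distinct colours, so at most one term is nonzero: the residual that `y`
  -- leaves in the equation coloured `n + t`.
  refine ⟨fun a t => ∑ r : Fin G × Fin K, if (r.1, a) ∈ I ∧ c a r = n + t then
    w r.1 a r.2 - ∑ l : Fin n, node a ^ (l : ℕ) * y r.1 r.2 l else 0, y, fun i a hia j => ?_⟩
  beta_reduce
  rcases lt_or_ge (c a (i, j)) n with h | h
  · rw [hy i j a hia h, Finset.sum_eq_zero, add_zero]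
    intro t _
    rw [if_neg (by omega), mul_zero]
  · have hcD := hlt a (i, j) hia
    rw [Finset.sum_eq_single (⟨c a (i, j) - n, by omega⟩ : Fin m)]
    · rw [Finset.sum_eq_single (i, j)]
      · have : c a (i, j) = n + (c a (i, j) - n) := by omega
        simp only [← this, hia, and_self, if_true]
        ring
      · intro r _ hr
        rw [if_neg]
        rintro ⟨h1, h2⟩
        refine hr (hcL a r (i, j) h1 hia ?_)
        simp only at h2
        omega
      · simp
    · intro t _ ht
      rw [if_neg, mul_zero]
      intro h2
      apply ht
      ext
      simp only
      omega
    · simp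

/-! ### Parametrisation of aligned clusters -/

/-- Parameters of aligned clusters: channel coefficients, and the free coordinates of the
normalised receive and transmit beamformers. -/
abbrev AlignmentParameter (G K m n : ℕ) : Type :=
  ChannelIndex G K (m + 1) (K + n) ⊕ ((Fin G × Fin K) × Fin m) ⊕ (Fin G × Fin K × Fin n)

open MvPolynomial in
/-- The channel coefficients obtained from free ones by solving the alignment equations for `I`
for the upper left `1 × K` blocks. -/
noncomputable def alignedChannel (G K m n : ℕ) (I : Finset (Fin G × (Fin G × Fin K)))
    (s : ChannelIndex G K (m + 1) (K + n)) : MvPolynomial (AlignmentParameter G K m n) ℂ :=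
  if (s.1, s.2.1) ∈ I ∧ s.2.2.1 = 0 then
    Fin.addCases (motive := fun _ => MvPolynomial (AlignmentParameter G K m n) ℂ)
      (fun j => -(∑ l, X (.inl (s.1, s.2.1, 0, Fin.natAdd K l)) * X (.inr (.inr (s.1, j, l))) +
        ∑ t, X (.inr (.inl (s.2.1, t))) * (X (.inl (s.1, s.2.1, t.succ, Fin.castAdd n j)) +
          ∑ l, X (.inl (s.1, s.2.1, t.succ, Fin.natAdd K l)) * X (.inr (.inr (s.1, j, l))))))
      (fun _ => X (.inl s)) s.2.2.2
  else X (.inl s)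

open MvPolynomial in
theorem partialIAFeasible_alignedChannel (G K m n : ℕ) (I : Finset (Fin G × (Fin G × Fin K)))
    (p : AlignmentParameter G K m n → ℂ) :
    PartialIAFeasible (fun s => eval p (alignedChannel G K m n I s)) I := by
  -- The conjugate cancels the one in the alignment equation, which keeps the parametrisation
  -- polynomial.
  refine ⟨fun a => Fin.cons 1 fun t => star (p (.inr (.inl (a, t)))),
    fun r => Fin.append (Pi.single r.2 1) fun l => p (.inr (.inr (r.1, r.2, l))), ?_, ?_, ?_⟩
  · intro a h
    simpa using congrFun h 0
  · intro g
    rw [Fintype.linearIndependent_iff]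
    intro c hc k
    have := congrFun hc (Fin.castAdd n k)
    simpa [Pi.single_apply] using this
  · intro i a hia j
    simp only [dotProduct, mulVec, channelMatrix, Fin.sum_univ_succ, Fin.sum_univ_add, of_apply,
      Pi.star_apply, Fin.cons_zero, Fin.cons_succ, Fin.append_left, Fin.append_right,
      Pi.single_apply, star_one, star_star, one_mul, mul_ite, mul_one, mul_zero,
      Finset.sum_ite_eq', Finset.mem_univ, if_true, alignedChannel, hia, true_and,
      Fin.addCases_left, Fin.addCases_right, Fin.succ_ne_zero, if_false, map_neg, map_add,
      map_sum, map_mul, eval_X]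
    ring

open MvPolynomial in
theorem injective_bind₁_alignedChannel {G K m n q : ℕ} (hD : K * q ≤ m + n)
    (I : Finset (Fin G × (Fin G × Fin K)))
    (hU : ∀ a : Fin G × Fin K, (Finset.univ.filter fun i : Fin G => (i, a) ∈ I).card ≤ q)
    (hB : ∀ i : Fin G,
      (Finset.univ.filter fun a : Fin G × Fin K => (i, a) ∈ I).card ≤ K * q) :
    Function.Injective (bind₁ (alignedChannel G K m n I)) := by
  obtain ⟨α, β, hαβ⟩ := exists_linearized_surjective hD I hU hB
  let H : ChannelIndex G K (m + 1) (K + n) → ℂ := fun s =>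
    Fin.cases (motive := fun _ => ℂ)
      (Fin.addCases (motive := fun _ => ℂ) (fun _ => 0) (α s.1 s.2.1) s.2.2.2)
      (fun t => Fin.addCases (motive := fun _ => ℂ) (fun j => β s.1 s.2.1 j t) (fun _ => 0)
        s.2.2.2) s.2.2.1
  -- At zero beamformer coordinates the terms containing both `x` and `y` have zero derivative; `H`
  -- carries `α` in its top row and `β` in its first `K` columns.
  refine injective_bind₁_of_hasDerivAt _ (Sum.elim H 0) fun w => ?_
  -- The sign is that of the solved coefficient, which is minus the remaining sum.
  obtain ⟨x, y, hxy⟩ := hαβ fun i a j => -w (i, a, 0, Fin.castAdd n j)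
  refine ⟨Sum.elim w (Sum.elim (fun b => x b.1 b.2) fun b => y b.1 b.2.1 b.2.2), ?_⟩
  rintro ⟨i, a, r, c⟩
  have hlin : ∀ s, HasDerivAt (fun z : ℂ => H s + z * w s) (w s) 0 := fun s => by
    simpa using ((hasDerivAt_id (0 : ℂ)).mul_const (w s)).const_add (H s)
  by_cases h : (i, a) ∈ I ∧ r = 0
  · obtain ⟨hia, rfl⟩ := h
    refine Fin.addCases (fun j => ?_) (fun l => ?_) c
    · simp only [alignedChannel, hia, and_self, if_true, Fin.addCases_left, map_neg, map_add,
        map_sum, map_mul, eval_X, Pi.add_apply, Pi.smul_apply, Sum.elim_inl, Sum.elim_inr,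
        smul_eq_mul, Pi.zero_apply, zero_add]
      have hid : ∀ b : ℂ, HasDerivAt (fun z : ℂ => z * b) b 0 := fun b => by
        simpa using (hasDerivAt_id (0 : ℂ)).mul_const b
      have hsum := ((HasDerivAt.fun_sum (u := Finset.univ) fun l _ =>
          (hlin (i, a, 0, Fin.natAdd K l)).mul (hid (y i j l))).add
        (HasDerivAt.fun_sum (u := Finset.univ) fun t _ => (hid (x a t)).mul
          ((hlin (i, a, t.succ, Fin.castAdd n j)).add
            (HasDerivAt.fun_sum (u := Finset.univ) fun l _ =>
              (hlin (i, a, t.succ, Fin.natAdd K l)).mul (hid (y i j l)))))).neg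
      refine hsum.congr_deriv ?_
      have := hxy i a hia j
      simp [H]
      rw [← neg_eq_iff_eq_neg.mpr this]
      simp
    · simpa [alignedChannel] using hlin (i, a, 0, Fin.natAdd K l)
  · have : alignedChannel G K m n I (i, a, r, c) = X (.inl (i, a, r, c)) := if_neg h
    simpa [this] using hlin (i, a, r, c)

theorem holdsGenerically_partialIAFeasible {G K M N q : ℕ} (hM : 1 ≤ M) (hN : K ≤ N)
    (hMN : K * (q + 1) + 1 ≤ M + N) (I : Finset (Fin G × (Fin G × Fin K)))
    (hU : ∀ a : Fin G × Fin K, (Finset.univ.filter fun i : Fin G => (i, a) ∈ I).card ≤ q)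
    (hB : ∀ i : Fin G,
      (Finset.univ.filter fun a : Fin G × Fin K => (i, a) ∈ I).card ≤ K * q) :
    HoldsGenerically fun h : ChannelIndex G K M N → ℂ => PartialIAFeasible h I := by
  obtain ⟨m, rfl⟩ := Nat.exists_eq_add_of_le' hM
  obtain ⟨n, rfl⟩ := Nat.exists_eq_add_of_le hN
  have hD : K * q ≤ m + n := by
    rw [mul_add] at hMN
    omega
  exact holdsGenerically_of_injective_bind₁ _ (injective_bind₁_alignedChannel hD I hU hB)
    (partialIAFeasible_alignedChannel G K m n I)

theorem corollary1 (G K M N : ℕ) (hM : 1 ≤ M) (hN : K ≤ N) :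
    (∀ q : ℕ, 1 ≤ q → q + 1 ≤ G → K * (q + 1) + 1 ≤ M + N →
      ∀ I : Finset (Fin G × (Fin G × Fin K)), I ⊆ allPairs G K →
        (∀ a : Fin G × Fin K, (Finset.univ.filter fun i : Fin G => (i, a) ∈ I).card ≤ q) →
        (∀ i : Fin G,
          (Finset.univ.filter fun a : Fin G × Fin K => (i, a) ∈ I).card ≤ K * q) →
        HoldsGenerically fun h : ChannelIndex G K M N → ℂ => PartialIAFeasible h I) ∧
    (2 ≤ G → G * K + 1 ≤ M + N →
      HoldsGenerically fun h : ChannelIndex G K M N → ℂ =>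
        PartialIAFeasible h (allPairs G K)) := by
  refine ⟨fun q _ _ hMN I _ hU hB => holdsGenerically_partialIAFeasible hM hN hMN I hU hB,
    fun hG hMN => ?_⟩
  refine holdsGenerically_partialIAFeasible (q := G - 1) hM hN ?_ _ (fun a => ?_) fun i => ?_
  · rwa [Nat.sub_add_cancel (by omega), mul_comm]
  · have : (Finset.univ.filter fun i : Fin G => (i, a) ∈ allPairs G K) =
        Finset.univ.erase a.1 := by
      ext i; simp [allPairs, eq_comm]
    rw [this, Finset.card_erase_of_mem (Finset.mem_univ _), Finset.card_univ, Fintype.card_fin]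
  · have : (Finset.univ.filter fun a : Fin G × Fin K => (i, a) ∈ allPairs G K) =
        Finset.univ.erase i ×ˢ Finset.univ := by
      ext a; simp [allPairs]
    rw [this, Finset.card_product, Finset.card_erase_of_mem (Finset.mem_univ _),
      Finset.card_univ, Finset.card_univ, Fintype.card_fin, Fintype.card_fin, mul_comm]
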